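/- Let $X$ be a (real or complex) Banach space with an unconditional basis $(e_i)_{i\in\mathbb N}$, and let $bb(X)$ denote the set of normalized block-bases of $(e_i)$, i.e. of infinite sequences $y=(y_n)_{n\in\mathbb N}$ of norm-one vectors of $X$, each finitely supported on $(e_i)$, with $\max \operatorname{supp}(y_n)<\min\operatorname{supp}(y_{n+1})$ for all $n$. A block-subspace of $X$ is the closed linear span $[y_n]_{n\in\mathbb N}$ of some $y\in bb(X)$. Let $A$ be a separable Banach space over the same field which is complementably universal for $bb(X)$ (every block-subspace of $X$ is isomorphic to a complemented subspace of $A$) and which is isomorphic to its square $A\oplus A$. Then there is a constant $C\ge 1$ such that $A$ is $C$-complementably universal for $bb(X)$: for every block-subspace $Y$ of $X$ there are $K,K'$ with $KK'\le C$ such that $Y$ is $K$-isomorphic to some $K'$-complemented subspace of $A$. Here $E$ and $F$ are $K$-isomorphic if there is an isomorphism $T$ from $E$ onto $F$ with $\|T\|\,\|T^{-1}\|\le K$, and a subspace is $K'$-complemented if it is the range of a bounded projection of norm at most $K'$. -/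

import Mathlib

/-- The support of a vector with respect to a basis `(e i)`: the set of indices of its nonzero
coordinates. -/
def basisSupport {𝕜 X : Type*} [NontriviallyNormedField 𝕜] [NormedAddCommGroup X] [NormedSpace 𝕜 X]
    {L : SummationFilter ℕ} (e : GeneralSchauderBasis ℕ 𝕜 X L) (x : X) : Set ℕ :=
  {i | e.coord i x ≠ 0}

/-- `bb(X)`: the (infinite) normalized block-bases of the basis `e` of `X`, that is, the sequences
of norm-one vectors which are finitely and successively supported on the basis. -/
structure IsNormalizedBlockBasis {𝕜 X : Type*} [NontriviallyNormedField 𝕜] [NormedAddCommGroup X]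
    [NormedSpace 𝕜 X] {L : SummationFilter ℕ} (e : GeneralSchauderBasis ℕ 𝕜 X L)
    (y : ℕ → X) : Prop where
  norm_eq_one : ∀ n, ‖y n‖ = 1
  finite_support : ∀ n, (basisSupport e (y n)).Finite
  successive : ∀ n, ∀ i ∈ basisSupport e (y n), ∀ j ∈ basisSupport e (y (n + 1)), i < j

/-- The closed linear span `[y]` of a sequence. -/
def closedSpan (𝕜 : Type*) {X : Type*} [NontriviallyNormedField 𝕜] [NormedAddCommGroup X]
    [NormedSpace 𝕜 X] (y : ℕ → X) : Submodule 𝕜 X :=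
  (Submodule.span 𝕜 (Set.range y)).topologicalClosure

/-- `Y` is a block-subspace of `X` (with respect to the basis `e`). -/
def IsBlockSubspace {𝕜 X : Type*} [NontriviallyNormedField 𝕜] [NormedAddCommGroup X]
    [NormedSpace 𝕜 X] {L : SummationFilter ℕ} (e : GeneralSchauderBasis ℕ 𝕜 X L)
    (Y : Submodule 𝕜 X) : Prop :=
  ∃ y : ℕ → X, IsNormalizedBlockBasis e y ∧ Y = closedSpan 𝕜 y

/-- `E` and `F` are `K`-isomorphic. -/
def AreIsomorphicWith (𝕜 : Type*) [NontriviallyNormedField 𝕜] (K : ℝ) (E F : Type*)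
    [NormedAddCommGroup E] [NormedSpace 𝕜 E] [NormedAddCommGroup F] [NormedSpace 𝕜 F] : Prop :=
  ∃ T : E ≃L[𝕜] F, ‖(T : E →L[𝕜] F)‖ * ‖(T.symm : F →L[𝕜] E)‖ ≤ K

/-- The subspace `F` of `A` is `K'`-complemented: it is the range of a bounded projection of norm
at most `K'`. -/
def IsComplementedWith {𝕜 A : Type*} [NontriviallyNormedField 𝕜] [NormedAddCommGroup A]
    [NormedSpace 𝕜 A] (K' : ℝ) (F : Submodule 𝕜 A) : Prop :=
  ∃ P : A →L[𝕜] A, (∀ a, P a ∈ F) ∧ (∀ a ∈ F, P a = a) ∧ ‖P‖ ≤ K'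

/-- `A` is complementably universal for `bb(X)`: every block-subspace of `X` is isomorphic to a
complemented subspace of `A`. -/
def IsComplementablyUniversal {𝕜 X : Type*} [NontriviallyNormedField 𝕜] [NormedAddCommGroup X]
    [NormedSpace 𝕜 X] {L : SummationFilter ℕ} (e : GeneralSchauderBasis ℕ 𝕜 X L)
    (A : Type*) [NormedAddCommGroup A] [NormedSpace 𝕜 A] : Prop :=
  ∀ Y : Submodule 𝕜 X, IsBlockSubspace e Y →
    ∃ F : Submodule 𝕜 A, F.ClosedComplemented ∧ Nonempty (Y ≃L[𝕜] F)

/-- `A` is `C`-complementably universal for `bb(X)`: every block-subspace of `X` is `K`-isomorphic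
to a `K'`-complemented subspace of `A`, for some `K` and `K'` with `K * K' ≤ C`. -/
def IsComplementablyUniversalWith {𝕜 X : Type*} [NontriviallyNormedField 𝕜] [NormedAddCommGroup X]
    [NormedSpace 𝕜 X] {L : SummationFilter ℕ} (C : ℝ) (e : GeneralSchauderBasis ℕ 𝕜 X L)
    (A : Type*) [NormedAddCommGroup A] [NormedSpace 𝕜 A] : Prop :=
  ∀ Y : Submodule 𝕜 X, IsBlockSubspace e Y →
    ∃ (F : Submodule 𝕜 A) (K K' : ℝ),
      AreIsomorphicWith 𝕜 K Y F ∧ IsComplementedWith K' F ∧ K * K' ≤ C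

/-! If no constant works, there are normalized block bases `y n` whose spans are worse and worse
embedded in `A`; a Baire category argument bounds them all at once. A point `x` of `ℕ → ℕ` selects
the vector `y n i` when `x` is constantly `n` on an interval carrying its support. Selected vectors
have disjoint intervals, and a generic `x` selects infinitely many, so they span a block-subspace,
whose identity factors through `A` with some integer constant. Hence for some `m` the set `G m` of
those `x` with constant `m` is nonmeagre. It is analytic, so it is comeagre in some cylinder of
length `L`.

Fix `n`. Split the indices `i ≥ L` into two classes by a generic 0-1 sequence, and overwrite a
generic point of the cylinder by `n` on the blocks of one class or of the other. Both results lie in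
`G m` (`exists_overwrite_mem`). By unconditionality the projections of `[y n]` onto the two classes
factor through `A` with constant `m * K` (`FactorsThrough.exists_projection`). The first `L` vectors
cost a constant independent of `n`. As `A` is isomorphic to `A × A`, the three operators add up to a
factorization of the identity (`FactorsThrough.add`), with a constant independent of `n`. -/

open Set Topology Filter MeasureTheory

/-! ### Category: nonmeagre analytic sets are comeagre in an open set -/

section BaireProperty

variable {α : Type*} [TopologicalSpace α]

/-- The interior of the set of points at which `s` is locally nonmeagre. -/
def nonmeagreInterior (s : Set α) : Set α :=
  interior {p | ∀ U, IsOpen U → p ∈ U → ¬ IsMeagre (U ∩ s)}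

theorem isOpen_nonmeagreInterior (s : Set α) : IsOpen (nonmeagreInterior s) := isOpen_interior

theorem nonmeagreInterior_subset_closure (s : Set α) : nonmeagreInterior s ⊆ closure s := by
  intro p hp
  rw [mem_closure_iff]
  exact fun U hU hpU => nonempty_of_not_isMeagre (interior_subset hp U hU hpU)

theorem not_isMeagre_inter_of_subset_nonmeagreInterior {s V : Set α} (hV : IsOpen V)
    (hne : (V ∩ nonmeagreInterior s).Nonempty) : ¬ IsMeagre (V ∩ s) := by
  obtain ⟨p, hpV, hp⟩ := hne
  exact interior_subset hp V hV hpV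

theorem IsClosed.isMeagre_diff_interior {s : Set α} (hs : IsClosed s) :
    IsMeagre (s \ interior s) := by
  rw [← hs.frontier_eq]
  exact IsNowhereDense.isMeagre (by
    rw [IsNowhereDense, isClosed_frontier.closure_eq, interior_frontier hs])

theorem inter_nonmeagreInterior_nonempty [SecondCountableTopology α] {s V : Set α}
    (hne : ¬ IsMeagre (V ∩ s)) : (V ∩ nonmeagreInterior s).Nonempty := by
  by_contra hemp
  apply hne
  -- Over a countable base, the union of the open sets in which `s` is meagre still meets `s` in a
  -- meagre set.
  set M : Set α := ⋃ U ∈ {U ∈ TopologicalSpace.countableBasis α | IsMeagre (U ∩ s)}, U with hM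
  have hMo : IsOpen M := isOpen_biUnion fun U hU =>
    TopologicalSpace.isOpen_of_mem_countableBasis hU.1
  have hMs : IsMeagre (M ∩ s) := by
    rw [hM, iUnion₂_inter]
    exact isMeagre_biUnion ((TopologicalSpace.countable_countableBasis α).mono fun U hU => hU.1)
      fun U hU => hU.2
  have hsub : Mᶜ ⊆ {p | ∀ U, IsOpen U → p ∈ U → ¬ IsMeagre (U ∩ s)} := by
    intro p hp U hU hpU hmeagre
    obtain ⟨W, hW, hpW, hWU⟩ :=
      (TopologicalSpace.isBasis_countableBasis α).exists_subset_of_mem_open hpU hU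
    exact hp (mem_biUnion ⟨hW, hmeagre.mono (inter_subset_inter_left _ hWU)⟩ hpW)
  refine (hMs.union (IsClosed.isMeagre_diff_interior hMo.isClosed_compl)).mono ?_
  rintro p ⟨hpV, hps⟩
  by_cases hp : p ∈ M
  · exact Or.inl ⟨hp, hps⟩
  · exact Or.inr ⟨hp, fun hpi => hemp ⟨p, hpV, interior_mono hsub hpi⟩⟩

/-- The difference is even nowhere dense: wherever `s` is locally nonmeagre some `t k` is nonmeagre,
so the open union on the right meets every open set in which the difference is dense. -/
theorem isMeagre_nonmeagreInterior_diff [SecondCountableTopology α] {κ : Type*} [Countable κ]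
    {s : Set α} {t : κ → Set α} (hst : s ⊆ ⋃ k, t k) :
    IsMeagre (nonmeagreInterior s \ ⋃ k, nonmeagreInterior (t k)) := by
  apply IsNowhereDense.isMeagre
  have hW : IsOpen (⋃ k, nonmeagreInterior (t k)) :=
    isOpen_iUnion fun k => isOpen_nonmeagreInterior _
  set W := ⋃ k, nonmeagreInterior (t k)
  set O := nonmeagreInterior s
  by_contra hne
  obtain ⟨p, hp⟩ := nonempty_iff_ne_empty.2 hne
  set V := interior (closure (O \ W))
  have hV : IsOpen V := isOpen_interior
  obtain ⟨q, hqV, hqO⟩ := mem_closure_iff.1 (interior_subset hp) V hV hp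
  have hVO : IsOpen (V ∩ O) := hV.inter (isOpen_nonmeagreInterior s)
  have h1 : ¬ IsMeagre ((V ∩ O) ∩ s) :=
    not_isMeagre_inter_of_subset_nonmeagreInterior hVO ⟨q, ⟨hqV, hqO.1⟩, hqO.1⟩
  have h2 : ∃ k, ¬ IsMeagre ((V ∩ O) ∩ t k) := by
    by_contra! hall
    refine h1 ((isMeagre_iUnion hall).mono ?_)
    rw [← inter_iUnion]
    exact inter_subset_inter_right _ hst
  obtain ⟨k, hk⟩ := h2
  obtain ⟨r, hrVO, hr⟩ := inter_nonmeagreInterior_nonempty hk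
  have hrW : r ∈ W := mem_iUnion.2 ⟨k, hr⟩
  obtain ⟨z, hz1, hz3⟩ := mem_closure_iff.1 (interior_subset hrVO.1) W hW hrW
  exact hz3.2 hz1

theorem PiNat.exists_cylinder_subset_of_mem_nhds {E : ℕ → Type*} [∀ n, TopologicalSpace (E n)]
    [∀ n, DiscreteTopology (E n)] {x : ∀ n, E n} {V : Set (∀ n, E n)} (hV : V ∈ 𝓝 x) :
    ∃ n, PiNat.cylinder x n ⊆ V := by
  obtain ⟨W, ⟨y, n, rfl⟩, hxW, hWV⟩ := (PiNat.isTopologicalBasis_cylinders E).mem_nhds_iff.1 hV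
  exact ⟨n, by rwa [PiNat.mem_cylinder_iff_eq.1 hxW]⟩

/-- A nonmeagre analytic set is comeagre in some nonempty open set. -/
theorem MeasureTheory.AnalyticSet.exists_isOpen_isMeagre_diff [SecondCountableTopology α]
    [RegularSpace α] [T1Space α] {s : Set α} (hs : AnalyticSet s) (hne : ¬ IsMeagre s) :
    ∃ U : Set α, IsOpen U ∧ U.Nonempty ∧ IsMeagre (U \ s) := by
  rw [AnalyticSet] at hs
  obtain rfl | ⟨f, hf, rfl⟩ := hs
  · exact absurd IsMeagre.empty hne
  set C : List ℕ → Set α := fun l => f '' {x | PiNat.res x l.length = l} with hC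
  have hCnil : C [] = range f := by simp [hC]
  have hCcons : ∀ l, C l ⊆ ⋃ k, C (k :: l) := by
    rintro l _ ⟨x, hx, rfl⟩
    exact mem_iUnion.2 ⟨x l.length, x, by simpa using hx, rfl⟩
  refine ⟨nonmeagreInterior (range f), isOpen_nonmeagreInterior _, ?_, ?_⟩
  · simpa using inter_nonmeagreInterior_nonempty (V := univ) (by simpa using hne)
  refine (isMeagre_iUnion fun l => isMeagre_nonmeagreInterior_diff (hCcons l)).mono ?_
  rintro p ⟨hp, hpf⟩
  by_contra hcon
  simp only [mem_iUnion, Set.mem_sdiff, not_exists, not_and, not_forall, not_not] at hcon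
  choose! g hg using hcon
  -- Outside the meagre exceptional set a branch can be followed forever. Lists grow at the head, as
  -- in `PiNat.res`. The images of the cylinders along the branch shrink to `f x`, while `p` is in
  -- the closure of each, so `p = f x`.
  let l : ℕ → List ℕ := fun n => Nat.rec [] (fun _ l => g l :: l) n
  have hl : ∀ n, p ∈ nonmeagreInterior (C (l n)) := by
    intro n
    induction n with
    | zero => exact hCnil ▸ hp
    | succ n ih => exact hg _ ih
  let x : ℕ → ℕ := fun n => g (l n)
  have hx : ∀ n, PiNat.res x n = l n := by
    intro n
    induction n with
    | zero => rfl
    | succ n ih => rw [PiNat.res_succ, ih]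
  apply hpf
  refine ⟨x, ?_⟩
  by_contra hxp
  obtain ⟨V, hVx, hVc, hVp⟩ := exists_mem_nhds_isClosed_subset
    (isOpen_compl_singleton.mem_nhds (show f x ∈ ({p} : Set α)ᶜ from hxp))
  have hVpre : f ⁻¹' V ∈ 𝓝 x := hf.continuousAt hVx
  obtain ⟨n, hn⟩ := PiNat.exists_cylinder_subset_of_mem_nhds hVpre
  have hCV : C (l n) ⊆ V := by
    rintro _ ⟨y, hy, rfl⟩
    apply hn
    rw [PiNat.cylinder_eq_res]
    rw [← hx n, PiNat.res_length] at hy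
    exact hy
  have := closure_minimal hCV hVc (nonmeagreInterior_subset_closure _ (hl n))
  exact hVp this rfl

end BaireProperty

/-! ### Factorizations of the identity through `A`, and their analyticity -/

section Factorization

/-- The operator `R` factors through `A` as `R = S ∘ T` with `‖T‖, ‖S‖ ≤ c`. -/
def FactorsThrough {𝕜 : Type*} (A : Type*) {Y : Type*} [NontriviallyNormedField 𝕜]
    [NormedAddCommGroup A] [NormedSpace 𝕜 A] [NormedAddCommGroup Y] [NormedSpace 𝕜 Y]
    (c : ℝ) (R : Y →L[𝕜] Y) : Prop :=
  ∃ (T : Y →L[𝕜] A) (S : A →L[𝕜] Y), S ∘L T = R ∧ ‖T‖ ≤ c ∧ ‖S‖ ≤ c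

/-- The closed linear span of the subfamily of `v` indexed by `s`. -/
def closedSpanOn (𝕜 : Type*) {X ι : Type*} [NontriviallyNormedField 𝕜] [NormedAddCommGroup X]
    [NormedSpace 𝕜 X] (v : ι → X) (s : Set ι) : Submodule 𝕜 X :=
  (Submodule.span 𝕜 (v '' s)).topologicalClosure

variable {𝕜 : Type*} [RCLike 𝕜] {X : Type*} [NormedAddCommGroup X] [NormedSpace 𝕜 X]
  {A : Type*} [NormedAddCommGroup A] [NormedSpace 𝕜 A] {ι : Type*}

theorem mem_closedSpanOn {v : ι → X} {s : Set ι} {i : ι} (hi : i ∈ s) :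
    v i ∈ closedSpanOn 𝕜 v s :=
  Submodule.le_topologicalClosure _ (Submodule.subset_span ⟨i, hi, rfl⟩)

theorem isClosed_closedSpanOn (v : ι → X) (s : Set ι) :
    IsClosed (closedSpanOn 𝕜 v s : Set X) :=
  Submodule.isClosed_topologicalClosure _

instance [CompleteSpace X] (v : ι → X) (s : Set ι) : CompleteSpace (closedSpanOn 𝕜 v s) :=
  (isClosed_closedSpanOn v s).completeSpace_coe

theorem closedSpanOn_le {v : ι → X} {s : Set ι} {E : Submodule 𝕜 X} (hE : IsClosed (E : Set X))
    (h : ∀ i ∈ s, v i ∈ E) : closedSpanOn 𝕜 v s ≤ E := by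
  refine Submodule.topologicalClosure_minimal _ (Submodule.span_le.2 ?_) hE
  rintro _ ⟨i, hi, rfl⟩
  exact h i hi

theorem mem_closedSpanOn_iff {v : ι → X} {s : Set ι} {x : X} :
    x ∈ closedSpanOn 𝕜 v s ↔
      ∀ n : ℕ, ∃ l : ι →₀ 𝕜, (l.support : Set ι) ⊆ s ∧
        ‖x - Finsupp.linearCombination 𝕜 v l‖ < 1 / ((n : ℝ) + 1) := by
  rw [closedSpanOn, ← SetLike.mem_coe, Submodule.topologicalClosure_coe, Metric.mem_closure_iff]
  constructor
  · intro h n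
    obtain ⟨y, hy, hxy⟩ := h _ (Nat.one_div_pos_of_nat (n := n))
    rw [SetLike.mem_coe, Finsupp.mem_span_image_iff_linearCombination] at hy
    obtain ⟨l, hl, rfl⟩ := hy
    exact ⟨l, (Finsupp.mem_supported 𝕜 l).1 hl, by rwa [dist_eq_norm] at hxy⟩
  · intro h ε hε
    obtain ⟨n, hn⟩ := exists_nat_one_div_lt hε
    obtain ⟨l, hl, hxl⟩ := h n
    refine ⟨_, ?_, by rw [dist_eq_norm]; exact hxl.trans hn⟩
    rw [SetLike.mem_coe, Finsupp.mem_span_image_iff_linearCombination]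
    exact ⟨l, (Finsupp.mem_supported 𝕜 l).2 hl, rfl⟩

theorem linearCombination_mem_closedSpanOn {v : ι → X} {s : Set ι} {l : ι →₀ 𝕜}
    (hl : (l.support : Set ι) ⊆ s) : Finsupp.linearCombination 𝕜 v l ∈ closedSpanOn 𝕜 v s := by
  rw [Finsupp.linearCombination_apply]
  exact Submodule.sum_mem _ fun i hi => Submodule.smul_mem _ _ (mem_closedSpanOn (hl hi))

theorem mk_linearCombination_eq_sum_attach {v : ι → X} {s : Set ι} {l : ι →₀ 𝕜}
    (hl : (l.support : Set ι) ⊆ s) :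
    (⟨_, linearCombination_mem_closedSpanOn hl⟩ : closedSpanOn 𝕜 v s) =
      ∑ i ∈ l.support.attach, l i • ⟨v i, mem_closedSpanOn (hl i.2)⟩ := by
  ext
  simp only [Finsupp.linearCombination_apply, Finsupp.sum, Submodule.coe_sum, Submodule.coe_smul]
  exact (Finset.sum_attach l.support fun i => l i • v i).symm

theorem dense_span_range_closedSpanOn (v : ι → X) (s : Set ι) :
    Dense (Submodule.span 𝕜 (range fun i : s =>
      (⟨v i, mem_closedSpanOn i.2⟩ : closedSpanOn 𝕜 v s)) : Set (closedSpanOn 𝕜 v s)) := by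
  classical
  intro y
  rw [Metric.mem_closure_iff]
  intro ε hε
  obtain ⟨n, hn⟩ := exists_nat_one_div_lt hε
  obtain ⟨l, hl, hyl⟩ := mem_closedSpanOn_iff.1 y.2 n
  refine ⟨⟨_, linearCombination_mem_closedSpanOn hl⟩, ?_, ?_⟩
  · rw [mk_linearCombination_eq_sum_attach hl]
    exact Submodule.sum_mem _ fun i _ => Submodule.smul_mem _ _
      (Submodule.subset_span ⟨⟨i, hl i.2⟩, rfl⟩)
  · rw [dist_eq_norm]
    exact lt_trans hyl hn

/-- Continuous linear maps on `[v i]_{i ∈ s}` which agree on the generators are equal. -/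
theorem closedSpanOn_hom_ext {v : ι → X} {s : Set ι} {B : Type*} [NormedAddCommGroup B]
    [NormedSpace 𝕜 B] {f g : closedSpanOn 𝕜 v s →L[𝕜] B}
    (h : ∀ i (hi : i ∈ s), f ⟨v i, mem_closedSpanOn hi⟩ = g ⟨v i, mem_closedSpanOn hi⟩) :
    f = g := by
  refine ContinuousLinearMap.ext_on (dense_span_range_closedSpanOn v s) ?_
  rintro _ ⟨i, rfl⟩
  exact h i i.2

/-- The family `w` need not be independent: the inequality forces every linear relation of `w` on
`a`. -/
theorem exists_continuousLinearMap_of_norm_linearCombination_le {κ Y B : Type*}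
    [NormedAddCommGroup Y] [NormedSpace 𝕜 Y] [NormedAddCommGroup B] [NormedSpace 𝕜 B]
    [CompleteSpace B] {w : κ → Y} (hw : Dense (Submodule.span 𝕜 (range w) : Set Y)) {a : κ → B}
    {c : ℝ} (hc : 0 ≤ c) (h : ∀ l : κ →₀ 𝕜,
      ‖Finsupp.linearCombination 𝕜 a l‖ ≤ c * ‖Finsupp.linearCombination 𝕜 w l‖) :
    ∃ T : Y →L[𝕜] B, (∀ k, T (w k) = a k) ∧ ‖T‖ ≤ c := by
  have hd : DenseRange (Finsupp.linearCombination 𝕜 w) := by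
    rwa [DenseRange, ← LinearMap.coe_range, Finsupp.range_linearCombination]
  refine ⟨(Finsupp.linearCombination 𝕜 a).extendOfNorm (Finsupp.linearCombination 𝕜 w),
    fun k => ?_, LinearMap.opNorm_extendOfNorm_le hd hc h⟩
  simpa using LinearMap.extendOfNorm_eq hd ⟨c, h⟩ (Finsupp.single k 1)

/-- Operators `T : [v i]_{i ∈ s} → A` and `S : A → [v i]_{i ∈ s}` with `S ∘ T = id` amount to the
values `a i = T (v i)` and the values `b k = S (d k)` on a dense sequence `d` of `A`. -/
theorem factorsThrough_id_closedSpanOn_iff [CompleteSpace X] [CompleteSpace A] {d : ℕ → A}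
    (hd : DenseRange d) (v : ι → X) (s : Set ι) {c : ℝ} (hc : 0 ≤ c) :
    FactorsThrough A c (ContinuousLinearMap.id 𝕜 (closedSpanOn 𝕜 v s)) ↔
      ∃ (a : ι → A) (b : ℕ → X),
        (∀ l : ι →₀ 𝕜, (l.support : Set ι) ⊆ s →
          ‖Finsupp.linearCombination 𝕜 a l‖ ≤ c * ‖Finsupp.linearCombination 𝕜 v l‖) ∧
        (∀ l : ℕ →₀ 𝕜,
          ‖Finsupp.linearCombination 𝕜 b l‖ ≤ c * ‖Finsupp.linearCombination 𝕜 d l‖) ∧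
        (∀ i ∈ s, ∀ k, ‖b k - v i‖ ≤ c * ‖d k - a i‖) ∧
        ∀ k, b k ∈ closedSpanOn 𝕜 v s := by
  classical
  constructor
  · rintro ⟨T, S, hST, hT, hS⟩
    let a : ι → A := fun i => if h : i ∈ s then T ⟨v i, mem_closedSpanOn h⟩ else 0
    have hST' : ∀ y, S (T y) = y := fun y => congrArg (fun f => f y) hST
    have hSle : ∀ z, ‖((S z : closedSpanOn 𝕜 v s) : X)‖ ≤ c * ‖z‖ := fun z =>
      (S.le_opNorm z).trans (by gcongr)
    refine ⟨a, fun k => S (d k), ?_, ?_, ?_, fun k => (S (d k)).2⟩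
    · intro l hl
      have : Finsupp.linearCombination 𝕜 a l = T ⟨_, linearCombination_mem_closedSpanOn hl⟩ := by
        rw [mk_linearCombination_eq_sum_attach hl, map_sum, Finsupp.linearCombination_apply,
          Finsupp.sum, ← Finset.sum_attach l.support fun i => l i • a i]
        refine Finset.sum_congr rfl fun i _ => ?_
        rw [map_smul]
        simp only [a]
        rw [dif_pos (hl i.2)]
      rw [this]
      exact (T.le_opNorm _).trans (by gcongr; exact le_rfl)
    · intro l
      have : Finsupp.linearCombination 𝕜 (fun k => ((S (d k) : closedSpanOn 𝕜 v s) : X)) l =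
          S (Finsupp.linearCombination 𝕜 d l) := by
        simp [Finsupp.linearCombination_apply, Finsupp.sum, map_sum]
      rw [this]
      exact hSle _
    · intro i hi k
      have : (v i : X) = S (a i) := by
        simp only [a]
        rw [dif_pos hi, hST']
      rw [this, ← Submodule.coe_sub, ← map_sub]
      exact hSle _
  · rintro ⟨a, b, ha, hb, hab, hbs⟩
    obtain ⟨T, hT, hTc⟩ := exists_continuousLinearMap_of_norm_linearCombination_le
      (dense_span_range_closedSpanOn (𝕜 := 𝕜) v s) (a := fun i : s => a i) hc (fun l => by
        have h1 := ha (l.mapDomain Subtype.val) (by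
          intro i hi
          obtain ⟨j, -, rfl⟩ := Finset.mem_image.1 (Finsupp.mapDomain_support hi)
          exact j.2)
        rw [Finsupp.linearCombination_mapDomain, Finsupp.linearCombination_mapDomain] at h1
        refine h1.trans_eq ?_
        rw [Submodule.coe_norm]
        simp [Finsupp.linearCombination_apply, Finsupp.sum])
    obtain ⟨S, hS, hSc⟩ := exists_continuousLinearMap_of_norm_linearCombination_le
      (hd.mono (Submodule.subset_span (R := 𝕜))) (B := closedSpanOn 𝕜 v s)
      (a := fun k => ⟨b k, hbs k⟩) hc (fun l => by
        refine le_trans (le_of_eq ?_) (hb l)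
        rw [Submodule.coe_norm]
        simp [Finsupp.linearCombination_apply, Finsupp.sum])
    have hSa : ∀ i ∈ s, (S (a i) : X) = v i := fun i hi => by
      -- The value `a i` need not belong to the dense sequence. The inequality passes from `d k` to
      -- all `z` by density, and `z = a i` gives `S (a i) = v i`.
      have hall : ∀ z : A, ‖(S z : X) - v i‖ ≤ c * ‖z - a i‖ := by
        refine fun z => hd.induction_on (p := fun z => ‖(S z : X) - v i‖ ≤ c * ‖z - a i‖) z ?_ ?_
        · exact isClosed_le (by fun_prop) (by fun_prop)
        · intro k
          rw [hS]
          exact hab i hi k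
      have := hall (a i)
      rw [sub_self, norm_zero, mul_zero] at this
      exact sub_eq_zero.1 (norm_le_zero_iff.1 this)
    refine ⟨T, S, closedSpanOn_hom_ext fun i hi => ?_, hTc, hSc⟩
    rw [ContinuousLinearMap.comp_apply, hT ⟨i, hi⟩]
    exact Subtype.ext (hSa i hi)

theorem continuous_linearCombination_family {κ B : Type*} [NormedAddCommGroup B]
    [NormedSpace 𝕜 B] (l : κ →₀ 𝕜) :
    Continuous fun a : κ → B => Finsupp.linearCombination 𝕜 a l := by
  simp only [Finsupp.linearCombination_apply, Finsupp.sum]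
  fun_prop

/-- If the membership of each index in `s p` is a clopen condition on `p`, then the set of those
`p` for which the identity of `[v i]_{i ∈ s p}` factors through `A` is analytic. -/
theorem analyticSet_setOf_factorsThrough_id [CompleteSpace X] [TopologicalSpace.SeparableSpace X]
    [CompleteSpace A] [TopologicalSpace.SeparableSpace A] [Countable ι]
    {P : Type*} [TopologicalSpace P] [PolishSpace P] (v : ι → X) (s : P → Set ι)
    (hs : ∀ i, IsClopen {p | i ∈ s p}) {c : ℝ} (hc : 0 ≤ c) :
    AnalyticSet {p | FactorsThrough A c (ContinuousLinearMap.id 𝕜 (closedSpanOn 𝕜 v (s p)))} := by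
  classical
  let d := TopologicalSpace.denseSeq A
  have hd : DenseRange d := TopologicalSpace.denseRange_denseSeq A
  have hsupp : ∀ l : ι →₀ 𝕜, IsOpen {p | (l.support : Set ι) ⊆ s p} := fun l => by
    have : {p | (l.support : Set ι) ⊆ s p} = ⋂ i ∈ l.support, {p | i ∈ s p} := by
      ext p; simp [subset_def]
    rw [this]
    exact isOpen_biInter_finset fun i _ => (hs i).isOpen
  let Z := P × (ι → A) × (ℕ → X)
  -- The witnesses `(a, b)` range over a Polish space. Openness of `i ∈ s p` makes the conditional
  -- inequalities closed and the approximation condition a Gδ, so the set in question is a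
  -- projection of a Borel set.
  let G : Set Z := ({z | ∀ l : ι →₀ 𝕜, (l.support : Set ι) ⊆ s z.1 →
          ‖Finsupp.linearCombination 𝕜 z.2.1 l‖ ≤ c * ‖Finsupp.linearCombination 𝕜 v l‖} ∩
        {z | ∀ l : ℕ →₀ 𝕜,
          ‖Finsupp.linearCombination 𝕜 z.2.2 l‖ ≤ c * ‖Finsupp.linearCombination 𝕜 d l‖}) ∩
        {z | ∀ i, i ∈ s z.1 → ∀ k, ‖z.2.2 k - v i‖ ≤ c * ‖d k - z.2.1 i‖} ∩
        ⋂ k, ⋂ n : ℕ, ⋃ l : ι →₀ 𝕜, ({z | (l.support : Set ι) ⊆ s z.1} ∩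
          {z | ‖z.2.2 k - Finsupp.linearCombination 𝕜 v l‖ < 1 / ((n : ℝ) + 1)})
  have hG : {p | FactorsThrough A c (ContinuousLinearMap.id 𝕜 (closedSpanOn 𝕜 v (s p)))} =
      Prod.fst '' G := by
    ext p
    rw [mem_ofPred_eq, factorsThrough_id_closedSpanOn_iff hd v (s p) hc]
    constructor
    · rintro ⟨a, b, h1, h2, h3, h4⟩
      refine ⟨(p, a, b), ⟨⟨⟨h1, h2⟩, h3⟩, ?_⟩, rfl⟩
      simp only [mem_iInter, mem_iUnion]
      exact fun k n => mem_closedSpanOn_iff.1 (h4 k) n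
    · rintro ⟨⟨p, a, b⟩, ⟨⟨⟨h1, h2⟩, h3⟩, h4⟩, rfl⟩
      simp only [mem_iInter, mem_iUnion] at h4
      exact ⟨a, b, h1, h2, h3, fun k => mem_closedSpanOn_iff.2 (h4 k)⟩
  have hc1 : IsClosed {z : Z | ∀ l : ι →₀ 𝕜, (l.support : Set ι) ⊆ s z.1 →
      ‖Finsupp.linearCombination 𝕜 z.2.1 l‖ ≤ c * ‖Finsupp.linearCombination 𝕜 v l‖} := by
    simp only [ofPred_forall]
    refine isClosed_iInter fun l => isClosed_imp ((hsupp l).preimage continuous_fst) ?_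
    exact isClosed_le (((continuous_linearCombination_family l).comp (continuous_fst.comp continuous_snd)).norm) continuous_const
  have hc2 : IsClosed {z : Z | ∀ l : ℕ →₀ 𝕜,
      ‖Finsupp.linearCombination 𝕜 z.2.2 l‖ ≤ c * ‖Finsupp.linearCombination 𝕜 d l‖} := by
    simp only [ofPred_forall]
    refine isClosed_iInter fun l => ?_
    exact isClosed_le (((continuous_linearCombination_family l).comp (continuous_snd.comp continuous_snd)).norm) continuous_const
  have hc3 : IsClosed {z : Z | ∀ i, i ∈ s z.1 → ∀ k,
      ‖z.2.2 k - v i‖ ≤ c * ‖d k - z.2.1 i‖} := by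
    simp only [ofPred_forall]
    refine isClosed_iInter fun i => isClosed_imp ((hs i).isOpen.preimage continuous_fst) ?_
    simp only [ofPred_forall]
    exact isClosed_iInter fun k => isClosed_le (by fun_prop) (by fun_prop)
  have hc4 : IsGδ (⋂ k, ⋂ n : ℕ, ⋃ l : ι →₀ 𝕜, ({z : Z | (l.support : Set ι) ⊆ s z.1} ∩
      {z | ‖z.2.2 k - Finsupp.linearCombination 𝕜 v l‖ < 1 / ((n : ℝ) + 1)})) := by
    refine .iInter fun k => .iInter fun n => (isOpen_iUnion fun l => ?_).isGδ
    refine ((hsupp l).preimage continuous_fst).inter (isOpen_lt ?_ continuous_const)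
    fun_prop
  rw [hG]
  borelize Z
  exact (((hc1.inter hc2).inter hc3).measurableSet.inter hc4.measurableSet).analyticSet
    |>.image_of_continuous continuous_fst

end Factorization

/-! ### Sums of factorizations and projections given by unconditionality -/

section Projections

variable {𝕜 : Type*} [RCLike 𝕜] {X : Type*} [NormedAddCommGroup X] [NormedSpace 𝕜 X]
  {A : Type*} [NormedAddCommGroup A] [NormedSpace 𝕜 A] {ι : Type*}

/-- The sum factors through `A × A` by the pair `(T₁, T₂)` and by `S₁ + S₂`; then `Φ` brings it back
to `A`. The hypothesis on the square of `A` acts only through this. -/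
theorem FactorsThrough.add (Φ : A ≃L[𝕜] A × A) {Y : Type*} [NormedAddCommGroup Y]
    [NormedSpace 𝕜 Y] {c₁ c₂ : ℝ} {R₁ R₂ : Y →L[𝕜] Y} (h₁ : FactorsThrough A c₁ R₁)
    (h₂ : FactorsThrough A c₂ R₂) :
    FactorsThrough A (max ‖(Φ : A →L[𝕜] A × A)‖ ‖(Φ.symm : A × A →L[𝕜] A)‖ * (c₁ + c₂))
      (R₁ + R₂) := by
  obtain ⟨T₁, S₁, rfl, hT₁, hS₁⟩ := h₁
  obtain ⟨T₂, S₂, rfl, hT₂, hS₂⟩ := h₂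
  have hc₁ : 0 ≤ c₁ := (norm_nonneg _).trans hT₁
  have hc₂ : 0 ≤ c₂ := (norm_nonneg _).trans hT₂
  refine ⟨(Φ.symm : A × A →L[𝕜] A) ∘L T₁.prod T₂, S₁.coprod S₂ ∘L (Φ : A →L[𝕜] A × A),
    ?_, ?_, ?_⟩
  · ext y
    simp
  · refine (ContinuousLinearMap.opNorm_comp_le _ _).trans ?_
    gcongr
    · exact le_max_right _ _
    · refine ContinuousLinearMap.opNorm_le_bound _ (by positivity) fun y => ?_
      rw [ContinuousLinearMap.prod_apply, Prod.norm_mk]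
      refine max_le ((T₁.le_of_opNorm_le hT₁ y).trans ?_) ((T₂.le_of_opNorm_le hT₂ y).trans ?_)
      · gcongr; linarith
      · gcongr; linarith
  · refine (ContinuousLinearMap.opNorm_comp_le _ _).trans ?_
    rw [mul_comm]
    gcongr
    · exact le_max_left _ _
    · refine ContinuousLinearMap.opNorm_le_bound _ (by positivity) fun z => ?_
      rw [ContinuousLinearMap.coprod_apply, add_mul]
      refine (norm_add_le _ _).trans (add_le_add ((S₁.le_of_opNorm_le hS₁ _).trans ?_)
        ((S₂.le_of_opNorm_le hS₂ _).trans ?_))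
      · gcongr; exact norm_fst_le z
      · gcongr; exact norm_snd_le z

/-- An operator of rank one factors through any nonzero space. -/
theorem FactorsThrough.of_range_subset_span_singleton [Nontrivial A] {Y : Type*}
    [NormedAddCommGroup Y] [NormedSpace 𝕜 Y] {K : ℝ} (hK : 1 ≤ K) {R : Y →L[𝕜] Y} (hR : ‖R‖ ≤ K)
    {y : Y} (hy : ‖y‖ = 1) (hRy : ∀ z, R z ∈ Submodule.span 𝕜 {y}) : FactorsThrough A K R := by
  obtain ⟨a₀, ha₀⟩ := exists_ne (0 : A)
  obtain ⟨φ, hφ, hφa⟩ := exists_dual_vector 𝕜 a₀ (norm_ne_zero_iff.2 ha₀)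
  obtain ⟨g, hg, hgy⟩ := exists_dual_vector 𝕜 y (by simp [hy])
  have ha₀' : (‖a₀‖ : 𝕜) ≠ 0 := by exact_mod_cast norm_ne_zero_iff.2 ha₀
  refine ⟨(g ∘L R).smulRight ((‖a₀‖ : 𝕜)⁻¹ • a₀), φ.smulRight y, ?_, ?_, ?_⟩
  · ext z
    obtain ⟨r, hr⟩ := Submodule.mem_span_singleton.1 (hRy z)
    simp [← hr, hgy, hy, hφa, ha₀']
  · rw [ContinuousLinearMap.norm_smulRight_apply, norm_smul, norm_inv, RCLike.norm_ofReal,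
      abs_norm, inv_mul_cancel₀ (norm_ne_zero_iff.2 ha₀), mul_one]
    refine (ContinuousLinearMap.opNorm_comp_le _ _).trans ?_
    rwa [hg, one_mul]
  · rw [ContinuousLinearMap.norm_smulRight_apply, hφ, hy, one_mul]
    exact hK

/-- The coordinate projections of an unconditional basis are uniformly bounded. -/
theorem UnconditionalSchauderBasis.exists_coordinate_projections [CompleteSpace X]
    (e : UnconditionalSchauderBasis ℕ 𝕜 X) :
    ∃ K : ℝ, 1 ≤ K ∧ ∀ W : Set ℕ, ∃ R : X →L[𝕜] X, ‖R‖ ≤ K ∧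
      (∀ x, basisSupport e x ⊆ W → R x = x) ∧ (∀ x, Disjoint (basisSupport e x) W → R x = 0) := by
  classical
  obtain ⟨C, hC⟩ := e.exists_norm_proj_le
  refine ⟨max C 1, le_max_right _ _, fun W => ?_⟩
  have hsum : ∀ x, Summable (W.indicator fun i => e.coord i x • e i) := fun x =>
    (e.expansion x).summable.indicator W
  let f : X →ₗ[𝕜] X :=
    { toFun := fun x => ∑' i, W.indicator (fun i => e.coord i x • e i) i
      map_add' := fun x y => by
        rw [← (hsum x).tsum_add (hsum y)]
        congr 1
        ext i
        by_cases hi : i ∈ W <;> simp [hi, add_smul]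
      map_smul' := fun c x => by
        rw [RingHom.id_apply, ← (hsum x).tsum_const_smul]
        congr 1
        ext i
        by_cases hi : i ∈ W <;> simp [hi, mul_smul] }
  have hf : ∀ x, ‖f x‖ ≤ max C 1 * ‖x‖ := fun x => by
    refine le_of_tendsto (hsum x).hasSum.norm (Eventually.of_forall fun s => ?_)
    have : ∑ i ∈ s, W.indicator (fun i => e.coord i x • e i) i =
        e.proj (s.filter (· ∈ W)) x := by
      rw [GeneralSchauderBasis.proj_apply, Finset.sum_filter]
      rfl
    rw [this]
    exact ContinuousLinearMap.le_of_opNorm_le _ ((hC _).trans (le_max_left _ _)) x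
  refine ⟨f.mkContinuous _ hf, f.mkContinuous_norm_le (by positivity) hf, fun x hx => ?_,
    fun x hx => ?_⟩
  · have : (W.indicator fun i => e.coord i x • e i) = fun i => e.coord i x • e i := by
      rw [indicator_eq_self]
      intro i hi
      refine hx fun h0 => hi ?_
      simp [h0]
    change ∑' i, W.indicator (fun i => e.coord i x • e i) i = x
    rw [this]
    exact (e.expansion x).tsum_eq
  · have : (W.indicator fun i => e.coord i x • e i) = 0 := by
      rw [indicator_eq_zero']
      refine Set.disjoint_left.2 fun i hi hiW => Set.disjoint_left.1 hx (fun h0 => hi ?_) hiW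
      simp [h0]
    change ∑' i, W.indicator (fun i => e.coord i x • e i) i = 0
    rw [this]
    exact tsum_zero

theorem map_mem_of_mem_closedSpanOn {v : ι → X} {s : Set ι} {E : Submodule 𝕜 X}
    (hE : IsClosed (E : Set X)) {R : X →L[𝕜] X} (h : ∀ i ∈ s, R (v i) ∈ E) {x : X}
    (hx : x ∈ closedSpanOn 𝕜 v s) : R x ∈ E :=
  closedSpanOn_le (E := E.comap (R : X →ₗ[𝕜] X)) (hE.preimage R.continuous) h hx

/-- If the members of `y` indexed by `t` are among the `v j`, `j ∈ s`, and the identity of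
`[v j]_{j ∈ s}` factors through `A`, so does the projection of `[y]` onto `[y i]_{i ∈ t}`. -/
theorem FactorsThrough.exists_projection {e : UnconditionalSchauderBasis ℕ 𝕜 X} {K : ℝ}
    (hK : ∀ W : Set ℕ, ∃ R : X →L[𝕜] X, ‖R‖ ≤ K ∧ (∀ x, basisSupport e x ⊆ W → R x = x) ∧
      (∀ x, Disjoint (basisSupport e x) W → R x = 0))
    {y : ℕ → X} (hy : Pairwise fun i j => Disjoint (basisSupport e (y i)) (basisSupport e (y j)))
    {v : ι → X} {s : Set ι}
    (hv : s.Pairwise fun i j => Disjoint (basisSupport e (v i)) (basisSupport e (v j)))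
    {t : Set ℕ} (hts : ∀ i ∈ t, ∃ j ∈ s, v j = y i) {c : ℝ}
    (h : FactorsThrough A c (ContinuousLinearMap.id 𝕜 (closedSpanOn 𝕜 v s))) :
    ∃ Q : closedSpanOn 𝕜 y univ →L[𝕜] closedSpanOn 𝕜 y univ, FactorsThrough A (c * K) Q ∧
      (∀ i ∈ t, Q ⟨y i, mem_closedSpanOn (mem_univ i)⟩ = ⟨y i, mem_closedSpanOn (mem_univ i)⟩) ∧
      ∀ i ∉ t, Q ⟨y i, mem_closedSpanOn (mem_univ i)⟩ = 0 := by
  -- By disjointness of supports `R` fixes the common vectors and kills all other `y i` and `v j`,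
  -- so it maps each of the two closed spans into the other. Inserting `S ∘ T = id` between two
  -- copies of `R` gives `Q`.
  obtain ⟨R, hRK, hR1, hR0⟩ := hK (⋃ i ∈ t, basisSupport e (y i))
  have hRy1 : ∀ i ∈ t, R (y i) = y i := fun i hi =>
    hR1 _ (subset_biUnion_of_mem (u := fun i => basisSupport e (y i)) hi)
  have hRy0 : ∀ i ∉ t, R (y i) = 0 := fun i hi => hR0 _ (by
    rw [disjoint_iUnion₂_right]
    exact fun j hj => hy (by rintro rfl; exact hi hj))
  have hyv : ∀ x ∈ closedSpanOn 𝕜 y univ, R x ∈ closedSpanOn 𝕜 v s := fun x hx => by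
    refine map_mem_of_mem_closedSpanOn (isClosed_closedSpanOn v s) (fun i _ => ?_) hx
    by_cases hi : i ∈ t
    · obtain ⟨j, hj, hji⟩ := hts i hi
      rw [hRy1 i hi, ← hji]
      exact mem_closedSpanOn hj
    · rw [hRy0 i hi]
      exact Submodule.zero_mem _
  have hvy : ∀ x ∈ closedSpanOn 𝕜 v s, R x ∈ closedSpanOn 𝕜 y univ := fun x hx => by
    refine map_mem_of_mem_closedSpanOn (isClosed_closedSpanOn y univ) (fun j hj => ?_) hx
    by_cases hji : ∃ i ∈ t, v j = y i
    · obtain ⟨i, hi, hji⟩ := hji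
      rw [hji, hRy1 i hi]
      exact mem_closedSpanOn (mem_univ i)
    · rw [hR0 (v j)]
      · exact Submodule.zero_mem _
      · rw [disjoint_iUnion₂_right]
        intro i hi
        obtain ⟨k, hk, hki⟩ := hts i hi
        rw [← hki]
        refine hv hj hk ?_
        rintro rfl
        exact hji ⟨i, hi, hki⟩
  obtain ⟨T, S, hST, hT, hS⟩ := h
  have hST' : ∀ x, S (T x) = x := fun x => congrArg (fun f => f x) hST
  have hc : 0 ≤ c := (norm_nonneg _).trans hT
  let R₁ : closedSpanOn 𝕜 y univ →L[𝕜] closedSpanOn 𝕜 v s :=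
    (R ∘L (closedSpanOn 𝕜 y univ).subtypeL).codRestrict _ fun x => hyv x x.2
  let R₂ : closedSpanOn 𝕜 v s →L[𝕜] closedSpanOn 𝕜 y univ :=
    (R ∘L (closedSpanOn 𝕜 v s).subtypeL).codRestrict _ fun x => hvy x x.2
  have hK0 : 0 ≤ K := (norm_nonneg _).trans hRK
  have hR₁ : ‖R₁‖ ≤ K := ContinuousLinearMap.opNorm_le_bound _ hK0 fun x =>
    R.le_of_opNorm_le hRK x
  have hR₂ : ‖R₂‖ ≤ K := ContinuousLinearMap.opNorm_le_bound _ hK0 fun x =>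
    R.le_of_opNorm_le hRK x
  refine ⟨R₂ ∘L R₁, ⟨T ∘L R₁, R₂ ∘L S, ?_, ?_, ?_⟩, fun i hi => ?_, fun i hi => ?_⟩
  · ext x
    simp [hST']
  · exact (ContinuousLinearMap.opNorm_comp_le _ _).trans (by gcongr)
  · rw [mul_comm]
    exact (ContinuousLinearMap.opNorm_comp_le _ _).trans (by gcongr)
  · refine Subtype.ext (?_ : R (R (y i)) = y i)
    rw [hRy1 i hi, hRy1 i hi]
  · refine Subtype.ext (?_ : R (R (y i)) = 0)
    rw [hRy0 i hi, map_zero]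

/-- The point is that `c` is chosen before `y`: each of the `L` rank-one coordinate projections has
norm at most `K`, whatever the block basis. -/
theorem exists_factorsThrough_initial_projection [Nontrivial A] (Φ : A ≃L[𝕜] A × A)
    {e : UnconditionalSchauderBasis ℕ 𝕜 X} {K : ℝ} (hK1 : 1 ≤ K)
    (hK : ∀ W : Set ℕ, ∃ R : X →L[𝕜] X, ‖R‖ ≤ K ∧ (∀ x, basisSupport e x ⊆ W → R x = x) ∧
      (∀ x, Disjoint (basisSupport e x) W → R x = 0)) (L : ℕ) :
    ∃ c : ℝ, ∀ y : ℕ → X, (∀ i, ‖y i‖ = 1) →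
      (Pairwise fun i j => Disjoint (basisSupport e (y i)) (basisSupport e (y j))) →
      ∃ Q : closedSpanOn 𝕜 y univ →L[𝕜] closedSpanOn 𝕜 y univ, FactorsThrough A c Q ∧
        (∀ i < L, Q ⟨y i, mem_closedSpanOn (mem_univ i)⟩ = ⟨y i, mem_closedSpanOn (mem_univ i)⟩) ∧
        ∀ i, L ≤ i → Q ⟨y i, mem_closedSpanOn (mem_univ i)⟩ = 0 := by
  induction L with
  | zero =>
    exact ⟨0, fun y _ _ => ⟨0, ⟨0, 0, by simp, by simp, by simp⟩, by simp, by simp⟩⟩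
  | succ L ih =>
    obtain ⟨c, hc⟩ := ih
    refine ⟨max ‖(Φ : A →L[𝕜] A × A)‖ ‖(Φ.symm : A × A →L[𝕜] A)‖ * (c + K),
      fun y hy1 hy => ?_⟩
    obtain ⟨Q, hQ, hQ1, hQ0⟩ := hc y hy1 hy
    obtain ⟨R, hRK, hR1, hR0⟩ := hK (basisSupport e (y L))
    have hRL : R (y L) = y L := hR1 _ subset_rfl
    have hRi : ∀ i, i ≠ L → R (y i) = 0 := fun i hi => hR0 _ (hy hi)
    have hmem : ∀ x ∈ closedSpanOn 𝕜 y univ, R x ∈ Submodule.span 𝕜 {y L} := fun x hx => by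
      refine map_mem_of_mem_closedSpanOn (Submodule.closed_of_finiteDimensional _)
        (fun i _ => ?_) hx
      by_cases hi : i = L
      · rw [hi, hRL]
        exact Submodule.mem_span_singleton_self _
      · rw [hRi i hi]
        exact Submodule.zero_mem _
    have hle : Submodule.span 𝕜 {y L} ≤ closedSpanOn 𝕜 y univ := by
      rw [Submodule.span_singleton_le_iff_mem]
      exact mem_closedSpanOn (mem_univ L)
    let P : closedSpanOn 𝕜 y univ →L[𝕜] closedSpanOn 𝕜 y univ :=
      (R ∘L (closedSpanOn 𝕜 y univ).subtypeL).codRestrict _ fun x => hle (hmem x x.2)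
    have hP : FactorsThrough A K P := by
      refine FactorsThrough.of_range_subset_span_singleton hK1
        (ContinuousLinearMap.opNorm_le_bound _ (by linarith) fun x => R.le_of_opNorm_le hRK x)
        (y := ⟨y L, mem_closedSpanOn (mem_univ L)⟩) (hy1 L) fun x => ?_
      obtain ⟨r, hr⟩ := Submodule.mem_span_singleton.1 (hmem x x.2)
      exact Submodule.mem_span_singleton.2 ⟨r, Subtype.ext hr⟩
    have hPL : P ⟨y L, mem_closedSpanOn (mem_univ L)⟩ = ⟨y L, mem_closedSpanOn (mem_univ L)⟩ :=
      Subtype.ext hRL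
    have hPi : ∀ i, i ≠ L → P ⟨y i, mem_closedSpanOn (mem_univ i)⟩ = 0 := fun i hi =>
      Subtype.ext (hRi i hi)
    refine ⟨Q + P, hQ.add Φ hP, fun i hi => ?_, fun i hi => ?_⟩
    · rw [_root_.add_apply]
      rcases Nat.lt_succ_iff_lt_or_eq.1 hi with hi | rfl
      · rw [hQ1 i hi, hPi i hi.ne, add_zero]
      · rw [hQ0 i le_rfl, hPL, zero_add]
    · rw [_root_.add_apply, hQ0 i (by omega), hPi i (by omega), add_zero]

end Projections

/-! ### Factorizations versus complemented copies -/

section Goodness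

variable {𝕜 : Type*} [RCLike 𝕜] {X : Type*} [NormedAddCommGroup X] [NormedSpace 𝕜 X]
  {A : Type*} [NormedAddCommGroup A] [NormedSpace 𝕜 A]

theorem exists_factorsThrough_id_of_equiv {Y : Type*} [NormedAddCommGroup Y] [NormedSpace 𝕜 Y]
    {F : Submodule 𝕜 A} (hF : F.ClosedComplemented) (U : Y ≃L[𝕜] F) :
    ∃ m : ℕ, FactorsThrough A m (ContinuousLinearMap.id 𝕜 Y) := by
  obtain ⟨p, hp⟩ := hF
  let T : Y →L[𝕜] A := F.subtypeL ∘L (U : Y →L[𝕜] F)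
  let S : A →L[𝕜] Y := (U.symm : F →L[𝕜] Y) ∘L p
  obtain ⟨m, hm⟩ := exists_nat_ge (max ‖T‖ ‖S‖)
  refine ⟨m, T, S, ?_, (le_max_left _ _).trans hm, (le_max_right _ _).trans hm⟩
  ext y
  simp [T, S, hp]

/-- If `S ∘ T = id`, then `T` is an isomorphism onto its range with inverse `S`, and `T ∘ S`
projects onto that range. -/
theorem FactorsThrough.exists_areIsomorphicWith_isComplementedWith {Y : Type*}
    [NormedAddCommGroup Y] [NormedSpace 𝕜 Y] {c : ℝ}
    (h : FactorsThrough A c (ContinuousLinearMap.id 𝕜 Y)) :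
    ∃ F : Submodule 𝕜 A, AreIsomorphicWith 𝕜 (c * c) Y F ∧ IsComplementedWith (c * c) F := by
  obtain ⟨T, S, hST, hT, hS⟩ := h
  have hST' : ∀ y, S (T y) = y := fun y => congrArg (fun f => f y) hST
  have hc : 0 ≤ c := (norm_nonneg _).trans hT
  let U : Y ≃L[𝕜] (T : Y →ₗ[𝕜] A).range :=
    ContinuousLinearEquiv.equivOfInverse
      (T.codRestrict _ fun y => LinearMap.mem_range_self (T : Y →ₗ[𝕜] A) y)
      (S ∘L (T : Y →ₗ[𝕜] A).range.subtypeL) (fun y => hST' y)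
      (by
        rintro ⟨_, y, rfl⟩
        exact Subtype.ext (congrArg T (hST' y)))
  refine ⟨(T : Y →ₗ[𝕜] A).range, ⟨U, ?_⟩, T ∘L S, fun a => ⟨S a, rfl⟩, ?_, ?_⟩
  · gcongr
    · exact ContinuousLinearMap.opNorm_le_bound _ hc fun y => T.le_of_opNorm_le hT y
    · exact ContinuousLinearMap.opNorm_le_bound _ hc fun y => S.le_of_opNorm_le hS y
  · rintro _ ⟨y, rfl⟩
    exact congrArg T (hST' y)
  · exact (ContinuousLinearMap.opNorm_comp_le _ _).trans (by gcongr)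

end Goodness

/-! ### Overwriting a generic point on complementary families of blocks -/

section Mixing

/-- Overwrite `z` by the constant `n` on the blocks `{j | idx j = i}` with `h i = β`, and by `u`
below `L`. -/
def overwrite (u : ℕ → ℕ) (L n : ℕ) (idx : ℕ → ℕ) (β : Bool) (p : (ℕ → Bool) × (ℕ → ℕ)) :
    ℕ → ℕ :=
  fun j => if j < L then u j else if p.1 (idx j) = β then n else p.2 j

variable (u : ℕ → ℕ) (L n : ℕ) {idx : ℕ → ℕ} (β : Bool)

theorem continuous_overwrite : Continuous (overwrite u L n idx β) := by
  refine continuous_pi fun j => ?_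
  have h : Continuous fun q : Bool × ℕ => if j < L then u j else if q.1 = β then n else q.2 :=
    continuous_of_discreteTopology
  have h' : Continuous fun p : (ℕ → Bool) × (ℕ → ℕ) => (p.1 (idx j), p.2 j) := by fun_prop
  exact h.comp h'

/-- Openness, with continuity, makes preimages of meagre sets meagre. It holds because overwriting
can be switched off from any block on, after which every continuation is attained. -/
theorem isOpenMap_overwrite {b : ℕ → ℕ} (hb : ∀ M j, b M ≤ j → M ≤ idx j) :
    IsOpenMap (overwrite u L n idx β) := by
  intro V hV
  rw [isOpen_iff_mem_nhds]
  rintro _ ⟨⟨h, z⟩, hm, rfl⟩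
  obtain ⟨s, hs, t, ht, hst⟩ := mem_nhds_prod_iff.1 (hV.mem_nhds hm)
  obtain ⟨a, ha⟩ := PiNat.exists_cylinder_subset_of_mem_nhds hs
  obtain ⟨a', ha'⟩ := PiNat.exists_cylinder_subset_of_mem_nhds ht
  obtain ⟨M, haM, hM⟩ : ∃ M, a ≤ M ∧ ∀ j < a', idx j < M := by
    refine ⟨(Finset.range a').sup idx + 1 + a, by omega, fun j hj => ?_⟩
    have := Finset.le_sup (f := idx) (Finset.mem_range.2 hj)
    omega
  refine mem_of_superset ((PiNat.isOpen_cylinder (fun _ : ℕ => ℕ) _ (max L (b M))).mem_nhds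
    (PiNat.self_mem_cylinder _ _)) fun w hw => ?_
  rw [PiNat.mem_cylinder_iff] at hw
  -- Value `!β` from block `M` on: there nothing is overwritten and `w` itself can serve as second
  -- coordinate.
  refine ⟨(fun i => if i < M then h i else !β, fun j => if idx j < M then z j else w j),
    hst ⟨ha ?_, ha' ?_⟩, ?_⟩
  · rw [PiNat.mem_cylinder_iff]
    exact fun i hi => if_pos (hi.trans_le haM)
  · rw [PiNat.mem_cylinder_iff]
    exact fun j hj => if_pos (hM j hj)
  · funext j
    by_cases hjL : j < L
    · rw [hw j (lt_max_of_lt_left hjL)]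
      simp [overwrite, hjL]
    by_cases hjM : idx j < M
    · rw [hw j (lt_max_of_lt_right (by by_contra! hj; exact absurd (hb M j hj) hjM.not_ge))]
      simp [overwrite, hjL, hjM]
    · simp [overwrite, hjL, hjM]

/-- In a set which is comeagre in an open set `U` there are two members whose constancy sets
(of value `n`) together cover all blocks far out. -/
theorem exists_overwrite_mem {G U : Set (ℕ → ℕ)} (hUG : IsMeagre (U \ G))
    (hu : PiNat.cylinder u L ⊆ U) {b : ℕ → ℕ} (hb : ∀ M j, b M ≤ j → M ≤ idx j) :
    ∃ p, ∀ β, overwrite u L n idx β p ∈ G := by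
  have hmeagre : ∀ β, IsMeagre (overwrite u L n idx β ⁻¹' (U \ G)) := fun β =>
    hUG.preimage_of_isOpenMap (continuous_overwrite u L n β) (isOpenMap_overwrite u L n β hb)
  have hres := (hmeagre true).union (hmeagre false)
  obtain ⟨p, hp⟩ := (dense_of_mem_residual hres).nonempty
  have hpU : ∀ β, overwrite u L n idx β p ∈ U := fun β => hu (by
    rw [PiNat.mem_cylinder_iff]
    exact fun i hi => if_pos hi)
  simp only [mem_compl_iff, mem_union, mem_preimage, not_or] at hp
  refine ⟨p, fun β => ?_⟩
  by_contra hβ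
  cases β
  · exact hp.2 ⟨hpU _, hβ⟩
  · exact hp.1 ⟨hpU _, hβ⟩

end Mixing

/-! ### Block bases coded by points of Baire space -/

section BlockBases

variable {𝕜 : Type*} [RCLike 𝕜] {X : Type*} [NormedAddCommGroup X] [NormedSpace 𝕜 X]

theorem basisSupport_nonempty (e : UnconditionalSchauderBasis ℕ 𝕜 X) {x : X} (hx : x ≠ 0) :
    (basisSupport e x).Nonempty := by
  by_contra h
  rw [not_nonempty_iff_eq_empty] at h
  have h0 : ∀ i, e.coord i x = 0 := fun i => by
    by_contra hi
    exact (h ▸ (show i ∈ basisSupport e x from hi) : i ∈ (∅ : Set ℕ))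
  refine hx ((e.expansion x).unique ?_)
  simp only [h0, zero_smul]
  exact hasSum_zero

theorem UnconditionalSchauderBasis.separableSpace (e : UnconditionalSchauderBasis ℕ 𝕜 X) :
    TopologicalSpace.SeparableSpace X := by
  have h := ((countable_range e.basis).isSeparable.span (R := 𝕜)).closure
  have hu : closure (Submodule.span 𝕜 (range e.basis) : Set X) = univ := by
    refine eq_univ_of_forall fun x => mem_closure_of_tendsto (e.tendsto_proj x)
      (Eventually.of_forall fun s => ?_)
    rw [GeneralSchauderBasis.proj_apply]
    exact Submodule.sum_mem _ fun i _ => Submodule.smul_mem _ _ (Submodule.subset_span ⟨i, rfl⟩)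
  rw [hu] at h
  exact TopologicalSpace.isSeparable_univ_iff.1 h

/-- The members of a block basis live on successive intervals. -/
theorem IsNormalizedBlockBasis.exists_intervals {e : UnconditionalSchauderBasis ℕ 𝕜 X}
    {y : ℕ → X} (hy : IsNormalizedBlockBasis e y) :
    ∃ lo hi : ℕ → ℕ, (∀ i, basisSupport e (y i) ⊆ Icc (lo i) (hi i)) ∧ (∀ i, lo i ≤ hi i) ∧
      ∀ i, hi i < lo (i + 1) := by
  have hne : ∀ i, (basisSupport e (y i)).Nonempty := fun i =>
    basisSupport_nonempty e (by
      intro h0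
      have := hy.norm_eq_one i
      rw [h0, norm_zero] at this
      exact zero_ne_one this)
  have hlo : ∀ i, sInf (basisSupport e (y i)) ∈ basisSupport e (y i) := fun i =>
    Nat.sInf_mem (hne i)
  have hhi : ∀ i, sSup (basisSupport e (y i)) ∈ basisSupport e (y i) := fun i =>
    Nat.sSup_mem (hne i) (hy.finite_support i).bddAbove
  exact ⟨fun i => sInf (basisSupport e (y i)), fun i => sSup (basisSupport e (y i)),
    fun i j hj => ⟨Nat.sInf_le hj, le_csSup (hy.finite_support i).bddAbove hj⟩,
    fun i => Nat.sInf_le (hhi i), fun i => hy.successive i _ (hhi i) _ (hlo (i + 1))⟩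

theorem isBlockSubspace_closedSpanOn {ι : Type*} {e : UnconditionalSchauderBasis ℕ 𝕜 X}
    {v : ι → X} {lo hi : ι → ℕ} (hv : ∀ p, ‖v p‖ = 1)
    (hsupp : ∀ p, basisSupport e (v p) ⊆ Icc (lo p) (hi p)) (hle : ∀ p, lo p ≤ hi p)
    {s : Set ι} (hs : s.Infinite)
    (hsep : ∀ p ∈ s, ∀ q ∈ s, p ≠ q → hi p < lo q ∨ hi q < lo p) :
    IsBlockSubspace e (closedSpanOn 𝕜 v s) := by
  have hinj : InjOn lo s := fun p hp q hq hpq => by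
    by_contra hne
    have h1 := hle p
    have h2 := hle q
    rcases hsep p hp q hq hne with h | h <;> omega
  -- The selected vectors are enumerated by increasing lower ends.
  have hM : {m | m ∈ lo '' s}.Infinite := hs.image hinj
  have hmem : ∀ n, Nat.nth (· ∈ lo '' s) n ∈ lo '' s := Nat.nth_mem_of_infinite hM
  choose g hgs hg using hmem
  refine ⟨fun n => v (g n), ⟨fun n => hv _, fun n => (finite_Icc _ _).subset (hsupp _), ?_⟩, ?_⟩
  · intro n i hi' j hj
    have hlt : lo (g n) < lo (g (n + 1)) := by
      rw [hg, hg]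
      exact Nat.nth_strictMono hM (Nat.lt_succ_self n)
    have h1 := hle (g (n + 1))
    have h2 := (hsupp _ hi').2
    have h3 := (hsupp _ hj).1
    rcases hsep _ (hgs n) _ (hgs (n + 1)) (by rintro h; rw [h] at hlt; exact lt_irrefl _ hlt)
      with h | h <;> omega
  · have : v '' s = range fun n => v (g n) := by
      ext x
      constructor
      · rintro ⟨p, hp, rfl⟩
        obtain ⟨k, hk⟩ : lo p ∈ range (Nat.nth (· ∈ lo '' s)) := by
          rw [Nat.range_nth_of_infinite hM]
          exact ⟨p, hp, rfl⟩
        exact ⟨k, congrArg v (hinj (hgs k) hp ((hg k).trans hk))⟩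
      · rintro ⟨n, rfl⟩
        exact ⟨g n, hgs n, rfl⟩
    rw [closedSpanOn, closedSpan, this]

/-- The pairs `(n, i)` such that the sequence `x` is constantly `n` on `[lo n i, hi n i]`. -/
def selectedBlocks (lo hi : ℕ → ℕ → ℕ) (x : ℕ → ℕ) : Set (ℕ × ℕ) :=
  {p | ∀ j ∈ Icc (lo p.1 p.2) (hi p.1 p.2), x j = p.1}

variable {lo hi : ℕ → ℕ → ℕ}

theorem isClopen_setOf_mem_selectedBlocks (p : ℕ × ℕ) :
    IsClopen {x | p ∈ selectedBlocks lo hi x} := by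
  have : {x | p ∈ selectedBlocks lo hi x} =
      ⋂ j ∈ Icc (lo p.1 p.2) (hi p.1 p.2), (fun x : ℕ → ℕ => x j) ⁻¹' {p.1} := by
    ext x
    simp [selectedBlocks]
  rw [this]
  exact (finite_Icc _ _).isClopen_biInter fun j _ =>
    (isClopen_discrete _).preimage (continuous_apply j)

theorem strictMono_lower_ends {lo hi : ℕ → ℕ} (hle : ∀ i, lo i ≤ hi i)
    (hlt : ∀ i, hi i < lo (i + 1)) : StrictMono lo :=
  strictMono_nat_of_lt_succ fun i => (hle i).trans_lt (hlt i)

theorem upper_lt_lower_of_lt {lo hi : ℕ → ℕ} (hle : ∀ i, lo i ≤ hi i)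
    (hlt : ∀ i, hi i < lo (i + 1)) {i j : ℕ} (hij : i < j) : hi i < lo j :=
  (hlt i).trans_le ((strictMono_lower_ends hle hlt).monotone hij)

theorem separated_of_mem_selectedBlocks (hle : ∀ n i, lo n i ≤ hi n i)
    (hlt : ∀ n i, hi n i < lo n (i + 1)) {x : ℕ → ℕ} :
    ∀ p ∈ selectedBlocks lo hi x, ∀ q ∈ selectedBlocks lo hi x, p ≠ q →
      hi p.1 p.2 < lo q.1 q.2 ∨ hi q.1 q.2 < lo p.1 p.2 := by
  rintro ⟨n, i⟩ hp ⟨k, j⟩ hq hne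
  by_cases hnk : n = k
  · subst hnk
    have hij : i ≠ j := fun h => hne (by rw [h])
    rcases hij.lt_or_gt with h | h
    · exact Or.inl (upper_lt_lower_of_lt (hle n) (hlt n) h)
    · exact Or.inr (upper_lt_lower_of_lt (hle n) (hlt n) h)
  · by_contra! hcon
    obtain ⟨h1, h2⟩ := hcon
    have h3 := hle n i
    have h4 := hle k j
    -- Overlapping intervals share this point, where `x` would take both values `n` and `k`.
    have h5 := hp (max (lo n i) (lo k j)) ⟨le_max_left _ _, max_le h3 h1⟩
    have h6 := hq (max (lo n i) (lo k j)) ⟨le_max_right _ _, max_le h2 h4⟩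
    exact hnk (h5.symm.trans h6)

/-- Blocks of the single basis of index `0` suffice: continuing any finite sequence by zeros selects
all late ones. -/
theorem setOf_infinite_selectedBlocks_mem_residual (hle : ∀ n i, lo n i ≤ hi n i)
    (hlt : ∀ n i, hi n i < lo n (i + 1)) :
    {x | (selectedBlocks lo hi x).Infinite} ∈ residual (ℕ → ℕ) := by
  have h : ∀ N : ℕ, (⋃ i ≥ N, {x | (0, i) ∈ selectedBlocks lo hi x}) ∈ residual (ℕ → ℕ) := by
    intro N
    refine residual_of_dense_open
      (isOpen_biUnion fun i _ => (isClopen_setOf_mem_selectedBlocks _).isOpen) fun x => ?_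
    rw [mem_closure_iff_nhds]
    intro V hV
    obtain ⟨n, hn⟩ := PiNat.exists_cylinder_subset_of_mem_nhds hV
    refine ⟨fun j => if j < n then x j else 0, hn ?_, ?_⟩
    · rw [PiNat.mem_cylinder_iff]
      exact fun j hj => if_pos hj
    · refine mem_iUnion₂.2 ⟨max N n, le_max_left _ _, fun j hj => ?_⟩
      have h1 := (strictMono_lower_ends (hle 0) (hlt 0)).le_apply (x := max N n)
      exact if_neg (not_lt.2 ((le_max_right N n).trans (h1.trans hj.1)))
  filter_upwards [countable_iInter_mem.2 h] with x hx
  simp only [mem_iInter, mem_iUnion] at hx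
  have hinf : {i | (0, i) ∈ selectedBlocks lo hi x}.Infinite := by
    rw [infinite_iff_exists_gt]
    intro N
    obtain ⟨i, hi, hix⟩ := hx (N + 1)
    exact ⟨i, hix, hi⟩
  exact (hinf.image (f := fun i => (0, i)) (fun i _ j _ h => (Prod.mk.inj h).2)).mono
    (by rintro _ ⟨i, hi, rfl⟩; exact hi)

end BlockBases

/-! ### The uniform constant -/

section Main

variable {𝕜 : Type*} [RCLike 𝕜] {X : Type*} [NormedAddCommGroup X] [NormedSpace 𝕜 X]
  {A : Type*} [NormedAddCommGroup A] [NormedSpace 𝕜 A]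

theorem FactorsThrough.mono {Y : Type*} [NormedAddCommGroup Y] [NormedSpace 𝕜 Y] {c c' : ℝ}
    (hcc : c ≤ c') {R : Y →L[𝕜] Y} (h : FactorsThrough A c R) : FactorsThrough A c' R := by
  obtain ⟨T, S, hST, hT, hS⟩ := h
  exact ⟨T, S, hST, hT.trans hcc, hS.trans hcc⟩

theorem closedSpan_eq_closedSpanOn_univ (y : ℕ → X) : closedSpan 𝕜 y = closedSpanOn 𝕜 y univ := by
  rw [closedSpan, closedSpanOn, image_univ]

theorem IsComplementablyUniversal.exists_factorsThrough {e : UnconditionalSchauderBasis ℕ 𝕜 X}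
    (hA : IsComplementablyUniversal e A) {Y : Submodule 𝕜 X} (hY : IsBlockSubspace e Y) :
    ∃ m : ℕ, FactorsThrough A m (ContinuousLinearMap.id 𝕜 Y) := by
  obtain ⟨F, hF, ⟨U⟩⟩ := hA Y hY
  exact exists_factorsThrough_id_of_equiv hF U

theorem IsComplementablyUniversal.nontrivial {e : UnconditionalSchauderBasis ℕ 𝕜 X}
    (hA : IsComplementablyUniversal e A) {y : ℕ → X} (hy : IsNormalizedBlockBasis e y) :
    Nontrivial A := by
  obtain ⟨m, T, S, hST, -, -⟩ := hA.exists_factorsThrough ⟨y, hy, rfl⟩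
  by_contra hnt
  rw [not_nontrivial_iff_subsingleton] at hnt
  have hmem : y 0 ∈ closedSpan 𝕜 y :=
    Submodule.le_topologicalClosure _ (Submodule.subset_span ⟨0, rfl⟩)
  have h1 : S (T ⟨y 0, hmem⟩) = ⟨y 0, hmem⟩ := congrArg (fun f => f ⟨y 0, hmem⟩) hST
  rw [Subsingleton.elim (T ⟨y 0, hmem⟩) 0, map_zero] at h1
  have h2 : (0 : X) = y 0 := congrArg Subtype.val h1
  have h3 := hy.norm_eq_one 0
  rw [← h2, norm_zero] at h3
  exact zero_ne_one h3

/-- Countably many block-subspaces embed complementably in `A` with a common constant. -/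
theorem exists_uniform_factorsThrough [CompleteSpace X] (e : UnconditionalSchauderBasis ℕ 𝕜 X)
    [CompleteSpace A] [TopologicalSpace.SeparableSpace A]
    (hA : IsComplementablyUniversal e A) (Φ : A ≃L[𝕜] A × A) {y : ℕ → ℕ → X}
    (hy : ∀ n, IsNormalizedBlockBasis e (y n)) :
    ∃ c : ℝ, ∀ n, FactorsThrough A c (ContinuousLinearMap.id 𝕜 (closedSpanOn 𝕜 (y n) univ)) := by
  have := e.separableSpace
  have := hA.nontrivial (hy 0)
  choose lo hi hsupp hle hlt using fun n => (hy n).exists_intervals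
  let v : ℕ × ℕ → X := fun p => y p.1 p.2
  let s : (ℕ → ℕ) → Set (ℕ × ℕ) := selectedBlocks lo hi
  let G : ℕ → Set (ℕ → ℕ) := fun m =>
    {x | FactorsThrough A m (ContinuousLinearMap.id 𝕜 (closedSpanOn 𝕜 v (s x)))}
  have hG : {x | (s x).Infinite} ⊆ ⋃ m, G m := fun x hx => mem_iUnion.2
    (hA.exists_factorsThrough (isBlockSubspace_closedSpanOn (v := v) (fun p => (hy _).norm_eq_one _)
      (fun p => hsupp p.1 p.2) (fun p => hle p.1 p.2) hx (separated_of_mem_selectedBlocks hle hlt)))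
  obtain ⟨m, hm⟩ : ∃ m, ¬ IsMeagre (G m) := by
    by_contra! hall
    exact not_isMeagre_of_mem_residual (setOf_infinite_selectedBlocks_mem_residual hle hlt)
      ((isMeagre_iUnion hall).mono hG)
  obtain ⟨U, hU, ⟨u, hu⟩, hUG⟩ := (analyticSet_setOf_factorsThrough_id (A := A) (𝕜 := 𝕜) v s
    isClopen_setOf_mem_selectedBlocks m.cast_nonneg).exists_isOpen_isMeagre_diff hm
  obtain ⟨L, hL⟩ := PiNat.exists_cylinder_subset_of_mem_nhds (hU.mem_nhds hu)
  obtain ⟨K, hK1, hK⟩ := e.exists_coordinate_projections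
  obtain ⟨c, hc⟩ := exists_factorsThrough_initial_projection (A := A) Φ hK1 hK L
  let κ := max ‖(Φ : A →L[𝕜] A × A)‖ ‖(Φ.symm : A × A →L[𝕜] A)‖
  -- Two additions of factorizations: constants `c` and `m * K`, then another `m * K`. None of `κ`,
  -- `c`, `m`, `K` depends on `n`.
  refine ⟨κ * (κ * (c + m * K) + m * K), fun n => ?_⟩
  have hmono := strictMono_lower_ends (hle n) (hlt n)
  -- The last block starting at or before `j`, with default `0` before the first block; it is `i` on
  -- the whole interval of block `i`.
  let idx : ℕ → ℕ := fun j => Nat.findGreatest (fun i => lo n i ≤ j) j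
  have hidx : ∀ M j, lo n M ≤ j → M ≤ idx j := fun M j hj =>
    Nat.le_findGreatest (hmono.le_apply.trans hj) hj
  have hidx_eq : ∀ i, ∀ j ∈ Icc (lo n i) (hi n i), idx j = i := fun i j hj => by
    refine le_antisymm ?_ (hidx i j hj.1)
    by_contra! hlt'
    have h1 : lo n (idx j) ≤ j :=
      Nat.findGreatest_spec (P := fun i => lo n i ≤ j) (hmono.le_apply.trans hj.1) hj.1
    exact absurd (upper_lt_lower_of_lt (hle n) (hlt n) hlt') (not_lt.2 (h1.trans hj.2))
  obtain ⟨p, hp⟩ := exists_overwrite_mem u L n hUG hL hidx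
  have hdisj : Pairwise fun i j => Disjoint (basisSupport e (y n i)) (basisSupport e (y n j)) := by
    intro i j hij
    refine Set.disjoint_left.2 fun k hk hk' => hij ?_
    rw [← hidx_eq i k (hsupp n i hk), ← hidx_eq j k (hsupp n j hk')]
  have hsel : ∀ β i, L ≤ i → p.1 i = β → (n, i) ∈ s (overwrite u L n idx β p) := by
    intro β i hi hβ j hj
    -- Since `i ≤ lo n i`, the blocks of index at least `L` lie beyond the fixed initial segment
    -- `u`.
    have hjL : ¬ j < L := not_lt.2 (hi.trans (hmono.le_apply.trans hj.1))
    simp only [overwrite, if_neg hjL, hidx_eq i j hj, if_pos hβ]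
  have hsep : ∀ x, (s x).Pairwise
      fun i j => Disjoint (basisSupport e (v i)) (basisSupport e (v j)) := by
    intro x q hq r hr hqr
    refine Set.disjoint_left.2 fun k hk hk' => ?_
    have h1 := hsupp _ _ hk
    have h2 := hsupp _ _ hk'
    rcases separated_of_mem_selectedBlocks hle hlt q hq r hr hqr with h | h
    · exact absurd (h1.2.trans_lt h) (not_lt.2 h2.1)
    · exact absurd (h2.2.trans_lt h) (not_lt.2 h1.1)
  have hproj := fun β => (hp β).exists_projection hK hdisj (hsep _)
    (t := {i | L ≤ i ∧ p.1 i = β}) fun i hi => ⟨(n, i), hsel β i hi.1 hi.2, rfl⟩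
  obtain ⟨Q, hQ, hQ1, hQ0⟩ := hc (y n) (hy n).norm_eq_one hdisj
  obtain ⟨P, hP, hP1, hP0⟩ := hproj true
  obtain ⟨P', hP', hP1', hP0'⟩ := hproj false
  have hid : ContinuousLinearMap.id 𝕜 (closedSpanOn 𝕜 (y n) univ) = Q + P + P' := by
    refine closedSpanOn_hom_ext fun i _ => ?_
    rw [_root_.add_apply, _root_.add_apply, ContinuousLinearMap.id_apply]
    by_cases hi : i < L
    · rw [hQ1 i hi, hP0 i fun h => absurd h.1 (not_le.2 hi),
        hP0' i fun h => absurd h.1 (not_le.2 hi), add_zero, add_zero]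
    · have hi' := not_lt.1 hi
      cases hβ : p.1 i
      · rw [hQ0 i hi', hP0 i fun h => absurd (hβ.symm.trans h.2) (by decide),
          hP1' i ⟨hi', hβ⟩, zero_add, zero_add]
      · rw [hQ0 i hi', hP1 i ⟨hi', hβ⟩,
          hP0' i fun h => absurd (hβ.symm.trans h.2) (by decide), zero_add, add_zero]
  rw [hid]
  exact (hQ.add Φ hP).add Φ hP'

end Main

theorem mainTheorem7 {𝕜 : Type*} [RCLike 𝕜]
    {X : Type*} [NormedAddCommGroup X] [NormedSpace 𝕜 X] [CompleteSpace X]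
    (e : UnconditionalSchauderBasis ℕ 𝕜 X)
    {A : Type*} [NormedAddCommGroup A] [NormedSpace 𝕜 A] [CompleteSpace A]
    [TopologicalSpace.SeparableSpace A]
    (hA : IsComplementablyUniversal e A) (hsq : Nonempty (A ≃L[𝕜] A × A)) :
    ∃ C : ℝ, 1 ≤ C ∧ IsComplementablyUniversalWith C e A := by
  obtain ⟨Φ⟩ := hsq
  by_contra! hcon
  have hbad : ∀ m : ℕ, ∃ y : ℕ → X, IsNormalizedBlockBasis e y ∧
      ¬ FactorsThrough A m (ContinuousLinearMap.id 𝕜 (closedSpanOn 𝕜 y univ)) := by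
    intro m
    -- A factorization with constant `m` bounds both the isomorphism constant and the projection
    -- norm by `m * m`.
    have h := hcon (max 1 ((m * m : ℝ) * (m * m))) (le_max_left _ _)
    simp only [IsComplementablyUniversalWith, not_forall] at h
    obtain ⟨Y, ⟨y, hy, rfl⟩, hY⟩ := h
    refine ⟨y, hy, fun hf => hY ?_⟩
    rw [← closedSpan_eq_closedSpanOn_univ] at hf
    obtain ⟨F, hF, hF'⟩ := hf.exists_areIsomorphicWith_isComplementedWith
    exact ⟨F, _, _, hF, hF', le_max_right _ _⟩
  choose y hy hbad using hbad
  obtain ⟨c, hc⟩ := exists_uniform_factorsThrough e hA Φ hy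
  obtain ⟨m, hm⟩ := exists_nat_ge c
  exact hbad m ((hc m).mono hm)
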